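/- Let $n\ge 1$ and $[n]=\{1,\dots,n\}$. An $[n]$-group is a group $\Gamma$ with subgroups $\Gamma_I$ ($I\subseteq[n]$) such that $\Gamma_{[n]}=\Gamma$ and $\Gamma_I\subseteq\Gamma_J$ whenever $I\subseteq J$; it is transitive if $\Gamma_I$ and $\Gamma_J$ are conjugate in $\Gamma$ whenever $|I|=|J|$. For $m\le n$, the $m$-commuting graph $X_m(\Gamma)$ has as vertices the $\Gamma$-conjugates of the subgroups $\Gamma_I$ with $|I|=m$, two distinct vertices being adjacent if the corresponding subgroups commute elementwise. Let $\Gamma$ be an $[n]$-group, let $G$ be a normal subgroup of $\Gamma$, and let $G=G(1)\supseteq G(2)\supseteq\cdots$ be a $\Gamma$-normal central series of $G$, i.e. a chain of subgroups that are normal in $\Gamma$ and satisfy $[G,G(k)]\subseteq G(k+1)$ for all $k\ge1$. Put $\mathcal L(k)=(G(k)/G(k+1))\otimes\mathbb R$, with the linear action of $\Gamma$ induced by conjugation, and for $I\subseteq[n]$ let $\mathcal L(k)_I\subseteq\mathcal L(k)$ be the subspace spanned by the image of $G(k)\cap\Gamma_I$. Let $d_\Gamma(\mathcal L(k))$ be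 the least $d\ge0$ such that $\mathcal L(k)$ is spanned by the $\Gamma$-orbits of the subspaces $\mathcal L(k)_I$ with $|I|=d$. The action of $\Gamma$ on a real vector space $V$ is called Zariski-irreducible if $\Gamma$ is an irreducible topological space in the pullback of the Zariski topology on $\mathrm{GL}(V)$ along $\Gamma\to\mathrm{GL}(V)$; here the Zariski-closed subsets of $\mathrm{GL}(V)$ are the common zero sets of families of real polynomials in the matrix coefficients $g\mapsto\varphi(gv)$ ($v\in V$, $\varphi\in V^*$). Fix an integer $N\ge1$ and assume: 1. the $[n]$-group $\Gamma$ is transitive; 2. $G$ is finitely generated; 3. the action of $\Gamma$ on $\mathcal L(k)$ is Zariski-irreducible for all $k\ge1$; 4. for some $m\le n$ with $m\ge d_\Gamma(\mathcal L(k))$ for all $1\le k<N$, the graph $X_m(\Gamma)$ is connected, and, if $X_m(\Gamma)$ has only one vertex, then the subgroup of $\Gamma$ that is this vertex is abelian. Then the group $G(k)$ is finitely generated for all $1\le k\le N$. -/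

import Mathlib

open scoped TensorProduct

noncomputable section

/-- An `[n]`-group structure on a group `Γ`; the index set `[n]` is modelled by `Fin n`. -/
structure NGroup (n : ℕ) (Γ : Type*) [Group Γ] where
  sub : Finset (Fin n) → Subgroup Γ
  sub_univ : sub Finset.univ = ⊤
  mono : ∀ {I J : Finset (Fin n)}, I ⊆ J → sub I ≤ sub J

/-- An `[n]`-vector space structure on a real vector space `V`. -/
structure NVectorSpace (n : ℕ) (V : Type*) [AddCommGroup V] [Module ℝ V] where
  sub : Finset (Fin n) → Submodule ℝ V
  sub_univ : sub Finset.univ = ⊤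
  mono : ∀ {I J : Finset (Fin n)}, I ⊆ J → sub I ≤ sub J

namespace NGroup

variable {n : ℕ} {Γ : Type*} [Group Γ]

/-- The inherited structure on a subgroup: `H_I = H ∩ Γ_I`. -/
def restrict (S : NGroup n Γ) (H : Subgroup Γ) : NGroup n H where
  sub I := (S.sub I).subgroupOf H
  sub_univ := by rw [S.sub_univ, Subgroup.top_subgroupOf]
  mono h := Subgroup.comap_mono (S.mono h)

/-- The inherited structure on a quotient: `(Γ / K)_I = Γ_I K / K`. -/
def quotient (S : NGroup n Γ) (K : Subgroup Γ) [K.Normal] : NGroup n (Γ ⧸ K) where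
  sub I := (S.sub I).map (QuotientGroup.mk' K)
  sub_univ := by
    rw [S.sub_univ]
    exact Subgroup.map_top_of_surjective _ (QuotientGroup.mk'_surjective K)
  mono h := Subgroup.map_mono (S.mono h)

/-- The conjugate `g H g⁻¹` of a subgroup. -/
def conjSubgroup (g : Γ) (H : Subgroup Γ) : Subgroup Γ :=
  H.map (MulAut.conj g).toMonoidHom

/-- `Γ_I` and `Γ_J` are conjugate in `Γ` whenever `|I| = |J|`. -/
def IsTransitive (S : NGroup n Γ) : Prop :=
  ∀ I J : Finset (Fin n), I.card = J.card → ∃ g : Γ, conjSubgroup g (S.sub I) = S.sub J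

/-- Two subgroups commute elementwise. -/
def CommuteElementwise (H K : Subgroup Γ) : Prop :=
  ∀ x ∈ H, ∀ y ∈ K, x * y = y * x

/-- The vertices of the `m`-commuting graph: the conjugates of the `Γ_I` with `|I| = m`,
as subgroups. -/
abbrev CommutingGraphVertex (S : NGroup n Γ) (m : ℕ) : Type _ :=
  {H : Subgroup Γ // ∃ I : Finset (Fin n), I.card = m ∧ ∃ g : Γ, H = conjSubgroup g (S.sub I)}

/-- The `m`-commuting graph `X_m(Γ)`. -/
def commutingGraph (S : NGroup n Γ) (m : ℕ) : SimpleGraph (S.CommutingGraphVertex m) where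
  Adj H K := H ≠ K ∧ CommuteElementwise H.1 K.1
  symm := ⟨fun _ _ h => ⟨h.1.symm, fun x hx y hy => (h.2 y hy x hx).symm⟩⟩
  loopless := ⟨fun _ h => h.1 rfl⟩

end NGroup

/-- `d_Γ(V)`: the least `d` such that `V` is spanned by the `Γ`-orbits of the `V_I` with
`|I| = d` (such `d` exist, as `d = n` is one). -/
def generationDegree {n : ℕ} {Γ V : Type*} [Group Γ] [AddCommGroup V] [Module ℝ V]
    (W : NVectorSpace n V) (ρ : Representation ℝ Γ V) : ℕ :=
  sInf {d : ℕ | Submodule.span ℝ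
    {x : V | ∃ I : Finset (Fin n), I.card = d ∧ ∃ γ : Γ, ∃ v ∈ W.sub I, x = ρ γ v} = ⊤}

/-- The real polynomial functions on `GL(V)`: the algebra of functions generated by the matrix
coefficients `g ↦ φ (g v)`. -/
def glPolynomialFunctions (V : Type*) [AddCommGroup V] [Module ℝ V] :
    Subalgebra ℝ (LinearMap.GeneralLinearGroup ℝ V → ℝ) :=
  Algebra.adjoin ℝ {f | ∃ (φ : Module.Dual ℝ V) (v : V), ∀ g, f g = φ ((g : V →ₗ[ℝ] V) v)}

/-- The Zariski topology on `GL(V)`: the basic open sets are the non-vanishing loci of polynomial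
functions, so the closed sets are the common zero loci of families of polynomial functions.
For finite-dimensional `V`, allowing the inverse of the determinant as well would not change the
zero loci. -/
abbrev zariskiTopology (V : Type*) [AddCommGroup V] [Module ℝ V] :
    TopologicalSpace (LinearMap.GeneralLinearGroup ℝ V) :=
  TopologicalSpace.generateFrom {U | ∃ f ∈ glPolynomialFunctions V, U = {g | f g ≠ 0}}

/-- The `V`-Zariski topology on `Γ`: the pullback of the Zariski topology under `Γ → GL(V)`. -/
abbrev pullbackZariskiTopology {Γ V : Type*} [Group Γ] [AddCommGroup V] [Module ℝ V]
    (ρ : Representation ℝ Γ V) : TopologicalSpace Γ :=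
  (zariskiTopology V).induced ρ.toHomUnits

/-- The action is Zariski-irreducible: `Γ` is irreducible in the `V`-Zariski topology. -/
def IsZariskiIrreducible {Γ V : Type*} [Group Γ] [AddCommGroup V] [Module ℝ V]
    (ρ : Representation ℝ Γ V) : Prop :=
  @IrreducibleSpace Γ (pullbackZariskiTopology ρ)

/-- A `Γ`-normal central series `G = G(1) ⊇ G(2) ⊇ ⋯` of a subgroup `G` of `Γ`. -/
structure NormalCentralSeries {Γ : Type*} [Group Γ] (G : Subgroup Γ) where
  term : ℕ+ → Subgroup Γ
  term_one : term 1 = G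
  succ_le : ∀ k, term (k + 1) ≤ term k
  commutator_le : ∀ k, ⁅G, term k⁆ ≤ term (k + 1)
  normal : ∀ k, (term k).Normal

namespace NormalCentralSeries

variable {Γ : Type*} [Group Γ] {G : Subgroup Γ}

instance instNormalTerm (s : NormalCentralSeries G) (k : ℕ+) : (s.term k).Normal := s.normal k

theorem term_le (s : NormalCentralSeries G) (k : ℕ+) : s.term k ≤ G := by
  induction k using PNat.recOn with
  | one => exact s.term_one.le
  | succ k ih => exact (s.succ_le k).trans ih

/-- The quotient `G(k) / G(k+1)`. -/
abbrev Subquotient (s : NormalCentralSeries G) (k : ℕ+) : Type _ :=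
  s.term k ⧸ (s.term (k + 1)).subgroupOf (s.term k)

instance instCommGroupSubquotient (s : NormalCentralSeries G) (k : ℕ+) : CommGroup (s.Subquotient k) :=
  { (inferInstance : Group (s.Subquotient k)) with
    mul_comm := by
      intro a b
      induction a using QuotientGroup.induction_on with
      | H a =>
      induction b using QuotientGroup.induction_on with
      | H b =>
      refine QuotientGroup.eq.2 ?_
      rw [Subgroup.mem_subgroupOf]
      have h := s.commutator_le k (Subgroup.commutator_mem_commutator
          (G.inv_mem (s.term_le k b.2)) ((s.term k).inv_mem a.2))
      simpa [commutatorElement_def, mul_assoc] using h }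

/-- The graded piece `ℒ(k) = (G(k) / G(k+1)) ⊗ ℝ`. -/
abbrev Graded (s : NormalCentralSeries G) (k : ℕ+) : Type _ :=
  ℝ ⊗[ℤ] Additive (s.Subquotient k)

/-- The canonical map `G(k) / G(k+1) → ℒ(k)`. -/
def toGraded (s : NormalCentralSeries G) (k : ℕ+) (q : s.Subquotient k) : s.Graded k :=
  (1 : ℝ) ⊗ₜ[ℤ] Additive.ofMul q

/-- The endomorphism of `G(k) / G(k+1)` induced by `g ↦ γ g γ⁻¹`. -/
def conjQuot (s : NormalCentralSeries G) (k : ℕ+) (γ : Γ) : s.Subquotient k →* s.Subquotient k :=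
  QuotientGroup.map _ _ (MulAut.conjNormal γ : MulAut (s.term k)).toMonoidHom (by
    intro x hx
    rw [Subgroup.mem_comap, Subgroup.mem_subgroupOf]
    rw [Subgroup.mem_subgroupOf] at hx
    simpa using (s.normal (k + 1)).conj_mem _ hx γ)

theorem conjQuot_one (s : NormalCentralSeries G) (k : ℕ+) :
    s.conjQuot k 1 = MonoidHom.id (s.Subquotient k) := by
  ext q
  simp [conjQuot]

theorem conjQuot_mul (s : NormalCentralSeries G) (k : ℕ+) (γ δ : Γ) :
    s.conjQuot k (γ * δ) = (s.conjQuot k γ).comp (s.conjQuot k δ) := by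
  ext q
  simp [conjQuot]

/-- The linear action of `Γ` on `ℒ(k)` induced by conjugation. -/
def conjRep (s : NormalCentralSeries G) (k : ℕ+) : Representation ℝ Γ (s.Graded k) where
  toFun γ := LinearMap.baseChange ℝ (MonoidHom.toAdditive (s.conjQuot k γ)).toIntLinearMap
  map_one' := by
    refine LinearMap.ext fun x => ?_
    induction x using TensorProduct.induction_on with
    | zero => simp only [map_zero]
    | tmul r q => rw [LinearMap.baseChange_tmul, conjQuot_one]; rfl
    | add x y hx hy => rw [map_add, map_add, hx, hy]
  map_mul' γ δ := by
    refine LinearMap.ext fun x => ?_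
    induction x using TensorProduct.induction_on with
    | zero => simp only [map_zero]
    | tmul r q =>
      rw [Module.End.mul_apply, LinearMap.baseChange_tmul, LinearMap.baseChange_tmul,
        LinearMap.baseChange_tmul, conjQuot_mul]
      rfl
    | add x y hx hy => rw [map_add, map_add, hx, hy]

/-- The `[n]`-vector space structure on `ℒ(k)`: `ℒ(k)_I` is spanned by the image of
`(G(k) / G(k+1))_I`, where `G(k) / G(k+1)` carries the `[n]`-group structure that it inherits as a
subquotient of `Γ`. -/
def gradedNVectorSpace {n : ℕ} (s : NormalCentralSeries G) (S : NGroup n Γ) (k : ℕ+) :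
    NVectorSpace n (s.Graded k) where
  sub I := Submodule.span ℝ (s.toGraded k ''
    (((S.restrict (s.term k)).quotient ((s.term (k + 1)).subgroupOf (s.term k))).sub I :
      Set (s.Subquotient k)))
  sub_univ := by
    rw [NGroup.sub_univ, eq_top_iff]
    intro x _
    induction x using TensorProduct.induction_on with
    | zero => exact Submodule.zero_mem _
    | tmul r q =>
      have : r ⊗ₜ[ℤ] q = r • s.toGraded k q.toMul := by
        simp [toGraded, TensorProduct.smul_tmul']
      rw [this]
      exact Submodule.smul_mem _ _ (Submodule.subset_span ⟨_, trivial, rfl⟩)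
    | add x y hx hy => exact Submodule.add_mem _ (hx trivial) (hy trivial)
  mono h := Submodule.span_mono (Set.image_mono (NGroup.mono _ h))

end NormalCentralSeries

end

/-!
The proof is by induction on `k`: if `G(k)` is finitely generated and `k < N`, then so is
`G(k + 1)` (`NormalCentralSeries.fg_succ`). Up to torsion, the finitely generated abelian group
`G(k) / G(k + 1)` is a lattice `ℤᵈ` in a Euclidean space `E`; let `v : G(k) → E` be the induced
homomorphism. The step rests on two facts.

*Geometry* (`MonoidHom.ker_fg_of_connIn_commute`). Suppose that for every nonzero linear form `u`
on `E` there is `x ∈ G(k)` with `u (v x) ≠ 0` that is linked to each conjugate `t x t⁻¹`, `t` in a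
finite generating set, by a chain of consecutively commuting elements on which `u ∘ v` does not
vanish. Then `G(k + 1)` is finitely generated. This is the criterion of Bieri, Neumann and Strebel,
proved directly. Powers of commuting elements of positive height are joined in the Cayley graph by
paths of great height, so that every edge of the Cayley graph can be pushed up along `u` by means
of `x` (`connIn_push`). The condition on `x` is open in `u`, so by compactness of the unit sphere
finitely many `x` suffice, and these may be taken as generators. Pushing towards the origin then
deforms any path between elements of `G(k + 1)` into a path whose image in `E` stays in a fixed ball
(`ConnIn.lt_of_le`), and a Schreier argument gives finitely many generators
(`MonoidHom.ker_fg_of_connIn`).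

*Algebra* (`NormalCentralSeries.exists_connIn_commute`). The form `u` extends to a nonzero linear
form `φ` on `ℒ(k)`. For each vertex `H` of the commuting graph, the set of `γ ∈ Γ` such that `φ` does
not vanish on the image of `γ H γ⁻¹ ∩ G(k)` is Zariski-open; it is nonempty since `Γ` is transitive
and `ℒ(k)` is generated in degree at most `m`. By irreducibility one `γ` serves any finite set of
vertices. Paths in the commuting graph from a vertex to its conjugates by generators thus yield the
chains of commuting elements.
-/

/-! ### Connectedness inside a subset -/

/-- `a` and `b` are joined by a finite sequence of `r`-steps all of whose vertices lie in `S`.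
The empty sequence is allowed, so that `a` is always joined to itself, even if `a ∉ S`. -/
def ConnIn {α : Type*} (r : α → α → Prop) (S : Set α) : α → α → Prop :=
  Relation.ReflTransGen fun a b => a ∈ S ∧ b ∈ S ∧ r a b

namespace ConnIn

variable {α β : Type*} {r : α → α → Prop} {r' : β → β → Prop} {S S' : Set α} {a b c : α}

theorem refl (a : α) : ConnIn r S a a := Relation.ReflTransGen.refl

theorem trans (h : ConnIn r S a b) (h' : ConnIn r S b c) : ConnIn r S a c :=
  Relation.ReflTransGen.trans h h'

theorem single (ha : a ∈ S) (hb : b ∈ S) (h : r a b) : ConnIn r S a b :=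
  Relation.ReflTransGen.single ⟨ha, hb, h⟩

theorem symm (hr : ∀ a b, r a b → r b a) (h : ConnIn r S a b) : ConnIn r S b a := by
  induction h with
  | refl => exact refl _
  | tail _ h ih => exact (single h.2.1 h.1 (hr _ _ h.2.2)).trans ih

theorem map (f : α → β) {T : Set β} (hS : ∀ a ∈ S, f a ∈ T)
    (hr : ∀ a ∈ S, ∀ b ∈ S, r a b → r' (f a) (f b)) (h : ConnIn r S a b) :
    ConnIn r' T (f a) (f b) := by
  induction h with
  | refl => exact refl _
  | tail _ h ih =>
    exact ih.trans (single (hS _ h.1) (hS _ h.2.1) (hr _ h.1 _ h.2.1 h.2.2))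

theorem mono (hS : S ⊆ S') (h : ConnIn r S a b) : ConnIn r S' a b :=
  h.map id hS fun _ _ _ _ h => h

theorem mem_right (h : ConnIn r S a b) (ha : a ∈ S) : b ∈ S := by
  induction h with
  | refl => exact ha
  | tail _ h _ => exact h.2.1

theorem exists_finite (h : ConnIn r S a b) : ∃ F ⊆ S, F.Finite ∧ ConnIn r F a b := by
  induction h with
  | refl => exact ⟨∅, Set.empty_subset _, Set.finite_empty, refl _⟩
  | @tail b c _ h ih =>
    obtain ⟨F, hF, hfin, hc⟩ := ih
    refine ⟨F ∪ {b, c}, ?_, hfin.union (Set.toFinite _), ?_⟩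
    · refine Set.union_subset hF ?_
      rintro x (rfl | rfl)
      exacts [h.1, h.2.1]
    · exact (hc.mono Set.subset_union_left).trans (single (by simp) (by simp) h.2.2)

end ConnIn

/-! ### Cayley graphs -/

section Cayley

variable {H : Type*} [Group H]

/-- Adjacency in the (left-invariant) Cayley graph: `q = p x` for some `x ∈ X`. -/
def CayleyAdj (X : Set H) (p q : H) : Prop := p⁻¹ * q ∈ X

variable {X S : Set H}

theorem CayleyAdj.symm (hX : ∀ x ∈ X, x⁻¹ ∈ X) (p q : H) (h : CayleyAdj X p q) :
    CayleyAdj X q p := by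
  have := hX _ h
  simpa [CayleyAdj] using this

theorem cayleyAdj_mul_right {x : H} (hx : x ∈ X) (p : H) : CayleyAdj X p (p * x) := by
  simpa [CayleyAdj] using hx

theorem ConnIn.cayley_mul_left {S' : Set H} {a b : H} (g : H) (h : ConnIn (CayleyAdj X) S a b)
    (hS : ∀ p ∈ S, g * p ∈ S') : ConnIn (CayleyAdj X) S' (g * a) (g * b) :=
  h.map (g * ·) hS fun a _ b _ hab => by simpa [CayleyAdj, mul_assoc] using hab

theorem connIn_cayley_univ (hX : ∀ x ∈ X, x⁻¹ ∈ X) (hgen : Subgroup.closure X = ⊤) (h : H) :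
    ConnIn (CayleyAdj X) Set.univ 1 h := by
  have hh : h ∈ Subgroup.closure X := hgen ▸ Subgroup.mem_top h
  induction hh using Subgroup.closure_induction with
  | mem x hx => exact .single trivial trivial (by simpa [CayleyAdj] using hx)
  | one => exact .refl _
  | mul x y _ _ hx hy =>
    refine hx.trans ?_
    simpa using hy.cayley_mul_left x (S' := Set.univ) fun _ _ => trivial
  | inv x _ hx =>
    have := (hx.symm (CayleyAdj.symm hX)).cayley_mul_left x⁻¹ (S' := Set.univ) fun _ _ => trivial
    simpa using this

/-- If every element of the kernel of `π` can be reached from `1` inside a set `S` with finite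
image under `π`, then the kernel is finitely generated. As in Schreier's lemma, generators are
`c(q) x c(q')⁻¹` for `x ∈ X`, where `c` is a section of `π` over `π(S)`. -/
theorem MonoidHom.ker_fg_of_connIn {Q : Type*} [Group Q] (π : H →* Q) (hX : X.Finite)
    (hS : (π '' S).Finite) (h : ∀ k ∈ π.ker, ConnIn (CayleyAdj X) S 1 k) : π.ker.FG := by
  classical
  let c : Q → H := fun q => if q = 1 then 1 else Function.invFun π q
  have hc1 : c 1 = 1 := by simp [c]
  have hc : ∀ g, π (c (π g)) = π g := by
    intro g
    by_cases hg : π g = 1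
    · simp [hg, hc1]
    · simpa [c, hg] using Function.invFun_eq (f := π) ⟨g, rfl⟩
  let Y : Set H := {y | y ∈ π.ker ∧ ∃ q ∈ π '' S, ∃ q' ∈ π '' S, ∃ x ∈ X, y = c q * x * (c q')⁻¹}
  have hY : Y.Finite := by
    refine ((hS.prod (hS.prod hX)).image
      fun z : Q × Q × H => c z.1 * z.2.2 * (c z.2.1)⁻¹).subset ?_
    rintro y ⟨-, q, hq, q', hq', x, hx, rfl⟩
    exact ⟨(q, q', x), ⟨hq, hq', hx⟩, rfl⟩
  have key : ∀ g, ConnIn (CayleyAdj X) S 1 g → g * (c (π g))⁻¹ ∈ Subgroup.closure Y := by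
    intro g hg
    induction hg with
    | refl => simp [hc1]
    | @tail a b _ hab ih =>
      have : b * (c (π b))⁻¹ =
          (a * (c (π a))⁻¹) * (c (π a) * (a⁻¹ * b) * (c (π b))⁻¹) := by group
      rw [this]
      refine mul_mem ih (Subgroup.subset_closure ⟨?_, _, ⟨a, hab.1, rfl⟩, _, ⟨b, hab.2.1, rfl⟩, _,
        hab.2.2, rfl⟩)
      simp [MonoidHom.mem_ker, hc]
  refine (Subgroup.fg_iff _).2 ⟨Y, le_antisymm ?_ fun k hk => ?_, hY⟩
  · exact (Subgroup.closure_le _).2 fun y hy => hy.1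
  · have := key k (h k hk)
    rwa [MonoidHom.mem_ker.1 hk, hc1, inv_one, mul_one] at this

end Cayley

/-! ### Maps that turn products into sums -/

section MapMul

variable {H E : Type*} [Group H] [AddCommGroup E] {v : H → E}

theorem map_one_of_map_mul (hv : ∀ a b, v (a * b) = v a + v b) : v 1 = 0 := by
  simpa using hv 1 1

theorem map_inv_of_map_mul (hv : ∀ a b, v (a * b) = v a + v b) (a : H) : v a⁻¹ = -v a := by
  have := hv a⁻¹ a
  rw [inv_mul_cancel, map_one_of_map_mul hv] at this
  exact (neg_eq_of_add_eq_zero_left this.symm).symm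

theorem map_pow_of_map_mul (hv : ∀ a b, v (a * b) = v a + v b) (a : H) (k : ℕ) :
    v (a ^ k) = k • v a := by
  induction k with
  | zero => simp [map_one_of_map_mul hv]
  | succ k ih => rw [pow_succ, hv, ih, succ_nsmul]

theorem map_conj_of_map_mul (hv : ∀ a b, v (a * b) = v a + v b) (a h : H) :
    v (h * a * h⁻¹) = v a := by
  rw [hv, hv, map_inv_of_map_mul hv]; abel

end MapMul

/-! ### Pushing edges of the Cayley graph along a character -/

section Push

variable {H E : Type*} [Group H] [NormedAddCommGroup E] [InnerProductSpace ℝ E]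
  {v : H → E} {X : Set H} {U : Set E}

local notation "⟪" x ", " y "⟫" => inner ℝ x y

theorem inner_map_pow (hv : ∀ a b, v (a * b) = v a + v b) (u : E) (a : H) (k : ℕ) :
    ⟪u, v (a ^ k)⟫ = k * ⟪u, v a⟫ := by
  rw [map_pow_of_map_mul hv, ← Nat.cast_smul_eq_nsmul ℝ, inner_smul_right]

/-- Right multiplication by a fixed element `h` costs a bounded amount of height. -/
theorem exists_forall_connIn_mul (hv : ∀ a b, v (a * b) = v a + v b)
    (hX : ∀ x ∈ X, x⁻¹ ∈ X) (hgen : Subgroup.closure X = ⊤) (hU : ∀ u ∈ U, ‖u‖ = 1) (h : H) :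
    ∃ B : ℝ, ∀ (C : ℝ) (g : H), (∀ u ∈ U, C + B < ⟪u, v g⟫) →
      ConnIn (CayleyAdj X) {p | ∀ u ∈ U, C < ⟪u, v p⟫} g (g * h) := by
  obtain ⟨F, -, hF, hc⟩ := (connIn_cayley_univ hX hgen h).exists_finite
  obtain ⟨B, hB⟩ := (hF.image fun p => ‖v p‖).bddAbove
  refine ⟨B, fun C g hg => ?_⟩
  have := hc.cayley_mul_left g (S' := {p | ∀ u ∈ U, C < ⟪u, v p⟫}) fun p hp u hu => ?_
  · simpa using this
  · have h1 : ‖v p‖ ≤ B := hB ⟨p, hp, rfl⟩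
    have h2 := (abs_le.1 (abs_real_inner_le_norm u (v p))).1
    rw [hU u hu, one_mul] at h2
    have h3 := hg u hu
    rw [hv, inner_add_right]
    linarith

/-- High powers of two commuting elements of positive height are joined at great height, by the
path `y ^ a → y ^ a * z ^ b = z ^ b * y ^ a → z ^ b`. -/
theorem Commute.connIn_pow (hv : ∀ a b, v (a * b) = v a + v b)
    (hX : ∀ x ∈ X, x⁻¹ ∈ X) (hgen : Subgroup.closure X = ⊤) (hU : ∀ u ∈ U, ‖u‖ = 1)
    {ε : ℝ} (hε : 0 < ε) {y z : H} (hyz : Commute y z)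
    (hy : ∀ u ∈ U, ε < ⟪u, v y⟫) (hz : ∀ u ∈ U, ε < ⟪u, v z⟫) (C : ℝ) :
    ∃ k : ℕ, ∀ a ≥ k, ∀ b ≥ k,
      ConnIn (CayleyAdj X) {p | ∀ u ∈ U, C < ⟪u, v p⟫} (y ^ a) (z ^ b) := by
  have half : ∀ {y z : H}, (∀ u ∈ U, ε < ⟪u, v y⟫) → (∀ u ∈ U, ε < ⟪u, v z⟫) →
      ∃ k : ℕ, ∀ a ≥ k, ∀ b,
        ConnIn (CayleyAdj X) {p | ∀ u ∈ U, C < ⟪u, v p⟫} (y ^ a) (y ^ a * z ^ b) := by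
    intro y z hy hz
    obtain ⟨B, hB⟩ := exists_forall_connIn_mul hv hX hgen hU z
    obtain ⟨k, hk⟩ := exists_nat_gt ((C + B) / ε)
    refine ⟨k, fun a ha b => ?_⟩
    induction b with
    | zero => simpa using ConnIn.refl _
    | succ b ih =>
      rw [pow_succ, ← mul_assoc]
      refine ih.trans (hB C _ fun u hu => ?_)
      rw [hv, inner_add_right, inner_map_pow hv, inner_map_pow hv]
      have h1 : C + B < k * ε := (div_lt_iff₀ hε).1 hk
      have h2 : (k : ℝ) * ε ≤ a * ⟪u, v y⟫ := by
        have : (k : ℝ) ≤ a := by exact_mod_cast ha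
        exact mul_le_mul this (hy u hu).le hε.le (Nat.cast_nonneg a)
      have h3 : 0 ≤ (b : ℝ) * ⟪u, v z⟫ := by
        have := hε.trans (hz u hu)
        positivity
      linarith
  obtain ⟨k, hk⟩ := half hy hz
  obtain ⟨l, hl⟩ := half hz hy
  refine ⟨max k l, fun a ha b hb => (hk a (le_of_max_le_left ha) b).trans ?_⟩
  rw [(hyz.pow_pow a b).eq]
  exact (hl b (le_of_max_le_right hb) a).symm (CayleyAdj.symm hX)

theorem connIn_pow_of_connIn_commute (hv : ∀ a b, v (a * b) = v a + v b)
    (hX : ∀ x ∈ X, x⁻¹ ∈ X) (hgen : Subgroup.closure X = ⊤) (hU : ∀ u ∈ U, ‖u‖ = 1)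
    {ε : ℝ} (hε : 0 < ε) {y z : H} (hy : ∀ u ∈ U, ε < ⟪u, v y⟫)
    (hyz : ConnIn Commute {y | ∀ u ∈ U, ε < ⟪u, v y⟫} y z) (C : ℝ) :
    ∃ k : ℕ, ∀ a ≥ k, ∀ b ≥ k,
      ConnIn (CayleyAdj X) {p | ∀ u ∈ U, C < ⟪u, v p⟫} (y ^ a) (z ^ b) := by
  induction hyz with
  | refl => exact (Commute.refl y).connIn_pow hv hX hgen hU hε hy hy C
  | tail _ h ih =>
    obtain ⟨k, hk⟩ := ih
    obtain ⟨l, hl⟩ := Commute.connIn_pow hv hX hgen hU hε h.2.2 h.1 h.2.1 C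
    exact ⟨max k l, fun a ha b hb => (hk a (le_of_max_le_left ha) (max k l) (le_max_left _ _)).trans
      (hl _ (le_max_right _ _) b (le_of_max_le_right hb))⟩

/-- The edge from `1` to `s` can be pushed up to a path from `x` to `s * x` that lies strictly
higher: climb to `x ^ a`, cross over to `(s * x * s⁻¹) ^ a` through powers of commuting elements,
and descend from `s * x ^ a`. -/
theorem connIn_push (hv : ∀ a b, v (a * b) = v a + v b)
    (hX : ∀ x ∈ X, x⁻¹ ∈ X) (hgen : Subgroup.closure X = ⊤) (hU : ∀ u ∈ U, ‖u‖ = 1)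
    {ε : ℝ} (hε : 0 < ε) {x s : H} (hxX : x ∈ X) (hsX : s ∈ X)
    (hx : ∀ u ∈ U, ε < ⟪u, v x⟫)
    (hxs : ConnIn Commute {y | ∀ u ∈ U, ε < ⟪u, v y⟫} x (s * x * s⁻¹)) :
    ConnIn (CayleyAdj X) {p | ∀ u ∈ U, min 0 ⟪u, v s⟫ + ε < ⟪u, v p⟫} x (s * x) := by
  set S : Set H := {p | ∀ u ∈ U, min 0 ⟪u, v s⟫ + ε < ⟪u, v p⟫}
  obtain ⟨k, hk⟩ := connIn_pow_of_connIn_commute hv hX hgen hU hε hx hxs ε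
  have hpow : ∀ u ∈ U, ∀ a : ℕ, ε < ⟪u, v (x ^ (a + 1))⟫ := by
    intro u hu a
    have := hx u hu
    rw [inner_map_pow hv]
    push_cast
    nlinarith [mul_nonneg (Nat.cast_nonneg (α := ℝ) a) (hε.trans this).le]
  have hmem : ∀ a : ℕ, x ^ (a + 1) ∈ S := fun a u hu => by
    have h1 := hpow u hu a
    have h2 := min_le_left (0 : ℝ) ⟪u, v s⟫
    linarith
  have hmem' : ∀ a : ℕ, s * x ^ (a + 1) ∈ S := fun a u hu => by
    have h1 := hpow u hu a
    have h2 := min_le_right (0 : ℝ) ⟪u, v s⟫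
    rw [hv, inner_add_right]
    linarith
  have up : ∀ a : ℕ, ConnIn (CayleyAdj X) S x (x ^ (a + 1)) := by
    intro a
    induction a with
    | zero => simpa using ConnIn.refl x
    | succ a ih =>
      refine ih.trans (.single (hmem a) (hmem (a + 1)) ?_)
      rw [pow_succ x (a + 1)]
      exact cayleyAdj_mul_right hxX _
  have down : ∀ a : ℕ, ConnIn (CayleyAdj X) S (s * x) (s * x ^ (a + 1)) := by
    intro a
    induction a with
    | zero => simpa using ConnIn.refl (s * x)
    | succ a ih =>
      refine ih.trans (.single (hmem' a) (hmem' (a + 1)) ?_)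
      rw [pow_succ x (a + 1), ← mul_assoc]
      exact cayleyAdj_mul_right hxX _
  have across : ConnIn (CayleyAdj X) S (x ^ (k + 1)) ((s * x * s⁻¹) ^ (k + 1)) :=
    (hk _ (Nat.le_succ k) _ (Nat.le_succ k)).mono fun p hp u hu => by
      have h1 := hp u hu
      have h2 := min_le_left (0 : ℝ) ⟪u, v s⟫
      linarith
  have hlast : (s * x * s⁻¹) ^ (k + 1) ∈ S := across.mem_right (hmem k)
  refine (up k).trans (across.trans (.trans (.single hlast (hmem' k) ?_)
    ((down k).symm (CayleyAdj.symm hX))))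
  rw [conj_pow]
  simpa using cayleyAdj_mul_right hsX (s * x ^ (k + 1) * s⁻¹)

end Push

/-! ### Retracting paths into a ball -/

section Descent

variable {H E : Type*} [Group H] [NormedAddCommGroup E] [InnerProductSpace ℝ E]
  {v : H → E} {X : Set H} {N : H → ℕ}

local notation "⟪" x ", " y "⟫" => inner ℝ x y

/-- A path in the ball `N ≤ r` between points of the smaller ball `N < r` can be deformed into the
smaller ball, if for every unit vector `u` there is a generator `t` with which all edges of
nonnegative `u`-height can be pushed up. -/
theorem ConnIn.lt_of_le (hv : ∀ a b, v (a * b) = v a + v b) (hN : ∀ h, ‖v h‖ ^ 2 = N h)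
    (hX : ∀ x ∈ X, x⁻¹ ∈ X) {δ D : ℝ}
    (hpush : ∀ u : E, ‖u‖ = 1 → ∃ t ∈ X, (δ < ⟪u, v t⟫ ∧ ‖v t‖ ≤ D) ∧
      ∀ s ∈ X, 0 ≤ ⟪u, v s⟫ →
        ConnIn (CayleyAdj X) {p | δ < ⟪u, v p⟫ ∧ ‖v p‖ ≤ D} t (s * t))
    {r : ℕ} (hr : D ^ 2 < 2 * δ * √r) {a b : H} (ha : N a < r) (hb : N b < r)
    (hab : ConnIn (CayleyAdj X) {h | N h ≤ r} a b) :
    ConnIn (CayleyAdj X) {h | N h < r} a b := by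
  classical
  have hr0 : 0 < √(r : ℝ) := by
    by_contra h
    have : √(r : ℝ) = 0 := le_antisymm (not_lt.1 h) (Real.sqrt_nonneg _)
    rw [this] at hr
    nlinarith
  -- On the boundary sphere there is a generator `t` that leads inwards and pushes inwards all
  -- edges that do not leave the ball.
  have main : ∀ w, N w = r → ∃ t ∈ X, N (w * t) < r ∧ ∀ s ∈ X, N (w * s) ≤ r →
      N (w * s * t) < r ∧ ConnIn (CayleyAdj X) {h | N h < r} (w * t) (w * s * t) := by
    intro w hw
    have hnorm : ‖v w‖ = √(r : ℝ) := by
      rw [← hw, ← hN, Real.sqrt_sq (norm_nonneg _)]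
    set u : E := -((√(r : ℝ))⁻¹ • v w) with hu
    have hu1 : ‖u‖ = 1 := by
      rw [hu, norm_neg, norm_smul, hnorm, norm_inv, Real.norm_of_nonneg hr0.le,
        inv_mul_cancel₀ hr0.ne']
    have hinner : ∀ p, ⟪v w, v p⟫ = -(√(r : ℝ) * ⟪u, v p⟫) := by
      intro p
      rw [hu, inner_neg_left, real_inner_smul_left]
      field_simp
    have hNw : ∀ p, (N (w * p) : ℝ) = r - 2 * √(r : ℝ) * ⟪u, v p⟫ + ‖v p‖ ^ 2 := by
      intro p
      rw [← hN, hv, norm_add_sq_real, hN w, hw, hinner]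
      ring
    have hgood : ∀ p, δ < ⟪u, v p⟫ ∧ ‖v p‖ ≤ D → N (w * p) < r := by
      rintro p ⟨h1, h2⟩
      have h3 : ‖v p‖ ^ 2 ≤ D ^ 2 := by gcongr
      have h4 : √(r : ℝ) * δ < √(r : ℝ) * ⟪u, v p⟫ := by gcongr
      have : (N (w * p) : ℝ) < r := by rw [hNw]; linarith
      exact_mod_cast this
    obtain ⟨t, htX, ht, hts⟩ := hpush u hu1
    refine ⟨t, htX, hgood t ht, fun s hs hws => ?_⟩
    have hs0 : 0 ≤ ⟪u, v s⟫ := by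
      have h1 : (N (w * s) : ℝ) ≤ r := by exact_mod_cast hws
      rw [hNw] at h1
      by_contra h
      have : √(r : ℝ) * ⟪u, v s⟫ < 0 := mul_neg_of_pos_of_neg hr0 (not_le.1 h)
      nlinarith [sq_nonneg ‖v s‖]
    have hc := hts s hs hs0
    rw [mul_assoc]
    exact ⟨hgood _ (hc.mem_right ht), hc.cayley_mul_left w hgood⟩
  choose! t htX ht hts using main
  -- A neighbour in the smaller ball of a boundary point `w` is joined to `w * t w`.
  have inner_nbr : ∀ w, N w = r → ∀ s ∈ X, N (w * s) < r →
      ConnIn (CayleyAdj X) {h | N h < r} (w * t w) (w * s) := by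
    intro w hw s hs hws
    obtain ⟨h1, h2⟩ := hts w hw s hs hws.le
    exact h2.trans (.single h1 hws (CayleyAdj.symm hX _ _ (cayleyAdj_mul_right (htX w hw) _)))
  let φ : H → H := fun w => if N w = r then w * t w else w
  have hφ : ∀ w, N w < r → φ w = w := fun w hw => if_neg hw.ne
  have hφ' : ∀ w, N w = r → φ w = w * t w := fun w hw => if_pos hw
  have step : ∀ p q, p ∈ {h | N h ≤ r} ∧ q ∈ {h | N h ≤ r} ∧ CayleyAdj X p q →
      ConnIn (CayleyAdj X) {h | N h < r} (φ p) (φ q) := by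
    rintro p q ⟨hp, hq, hpq⟩
    have e1 : p * (p⁻¹ * q) = q := by group
    have e2 : q * (q⁻¹ * p) = p := by group
    rcases lt_or_eq_of_le (show N p ≤ r from hp) with hp | hp <;>
      rcases lt_or_eq_of_le (show N q ≤ r from hq) with hq | hq
    · rw [hφ p hp, hφ q hq]
      exact .single hp hq hpq
    · rw [hφ p hp, hφ' q hq]
      have := inner_nbr q hq (q⁻¹ * p) (CayleyAdj.symm hX _ _ hpq) (by rwa [e2])
      rw [e2] at this
      exact this.symm (CayleyAdj.symm hX)
    · rw [hφ' p hp, hφ q hq]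
      have := inner_nbr p hp (p⁻¹ * q) hpq (by rwa [e1])
      rwa [e1] at this
    · rw [hφ' p hp, hφ' q hq]
      obtain ⟨h1, h2⟩ := hts p hp (p⁻¹ * q) hpq (by rw [e1, hq])
      rw [e1] at h1 h2
      exact h2.trans ((inner_nbr q hq (t p) (htX p hp) h1).symm (CayleyAdj.symm hX))
  have key : ∀ b, ConnIn (CayleyAdj X) {h | N h ≤ r} a b →
      ConnIn (CayleyAdj X) {h | N h < r} (φ a) (φ b) := by
    intro b hb
    induction hb with
    | refl => exact .refl _
    | tail _ h ih => exact ih.trans (step _ _ h)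
  have := key b hab
  rwa [hφ a ha, hφ b hb] at this

end Descent

/-! ### Finite generation of kernels from chains of commuting elements -/

section Kernel

open Filter Topology

variable {H E : Type*} [Group H] [NormedAddCommGroup E] [InnerProductSpace ℝ E] {v : H → E}

local notation "⟪" x ", " y "⟫" => inner ℝ x y

/-- Elements of nonzero height in a chain of commuting elements may be replaced by their inverses
so as to have positive height. -/
theorem exists_connIn_commute_pos (hv : ∀ a b, v (a * b) = v a + v b) {u : E} {T : Set H} {x : H}
    (hx : ⟪u, v x⟫ ≠ 0)
    (hT : ∀ s ∈ T, ConnIn Commute {y | ⟪u, v y⟫ ≠ 0} x (s * x * s⁻¹)) :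
    ∃ x, 0 < ⟪u, v x⟫ ∧ ∀ s ∈ T, ConnIn Commute {y | 0 < ⟪u, v y⟫} x (s * x * s⁻¹) := by
  classical
  let f : H → H := fun y => if 0 < ⟪u, v y⟫ then y else y⁻¹
  have hpos : ∀ y, ⟪u, v y⟫ ≠ 0 → 0 < ⟪u, v (f y)⟫ := by
    intro y hy
    by_cases h : 0 < ⟪u, v y⟫
    · simp [f, h]
    · have : ⟪u, v y⟫ < 0 := lt_of_le_of_ne (not_lt.1 h) hy
      simpa [f, h, map_inv_of_map_mul hv] using this
  have hcomm : ∀ y z, Commute y z → Commute (f y) (f z) := by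
    intro y z h
    by_cases h1 : 0 < ⟪u, v y⟫ <;> by_cases h2 : 0 < ⟪u, v z⟫ <;> simp [f, h1, h2, h]
  have hconj : ∀ s, f (s * x * s⁻¹) = s * f x * s⁻¹ := by
    intro s
    have := map_conj_of_map_mul hv x s
    by_cases h : 0 < ⟪u, v x⟫ <;> simp only [f, this, h, if_true, if_false, conj_inv]
  refine ⟨f x, hpos x hx, fun s hs => ?_⟩
  rw [← hconj]
  exact (hT s hs).map f hpos fun a _ b _ h => hcomm a b h

/-- A chain from `x` to each of its conjugates by generators yields chains to all its conjugates,
since the height is invariant under conjugation. -/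
theorem connIn_commute_conj {S : Set H} (hS : ∀ h, ∀ y ∈ S, h * y * h⁻¹ ∈ S) {T : Set H}
    (hgen : Subgroup.closure T = ⊤) {x : H}
    (hT : ∀ s ∈ T, ConnIn Commute S x (s * x * s⁻¹)) (h : H) :
    ConnIn Commute S x (h * x * h⁻¹) := by
  have conj : ∀ (g : H) {a b : H}, ConnIn Commute S a b →
      ConnIn Commute S (g * a * g⁻¹) (g * b * g⁻¹) := fun g a b hab =>
    hab.map (fun y => g * y * g⁻¹) (hS g) fun a _ b _ hab =>
      by simpa using hab.map (MulAut.conj g)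
  have hh : h ∈ Subgroup.closure T := hgen ▸ Subgroup.mem_top h
  induction hh using Subgroup.closure_induction with
  | mem s hs => exact hT s hs
  | one => simpa using ConnIn.refl x
  | mul a b _ _ ha hb => simpa [mul_assoc] using ha.trans (conj a hb)
  | inv a _ ha =>
    simpa [mul_assoc] using (conj a⁻¹ ha).symm fun _ _ h => h.symm

/-- A chain of commuting elements of positive `u`-height also has heights bounded below by a
positive constant for all `u'` near `u`. -/
theorem exists_nhds_connIn_commute (hv : ∀ a b, v (a * b) = v a + v b) {u : E} {T : Set H}
    (hTfin : T.Finite) (hgen : Subgroup.closure T = ⊤) {x : H} (hx : ⟪u, v x⟫ ≠ 0)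
    (hT : ∀ s ∈ T, ConnIn Commute {y | ⟪u, v y⟫ ≠ 0} x (s * x * s⁻¹)) :
    ∃ (x : H) (ε : ℝ), 0 < ε ∧ ∃ W ∈ 𝓝 u, (∀ u' ∈ W, ε < ⟪u', v x⟫) ∧
      ∀ h, ConnIn Commute {y | ∀ u' ∈ W, ε < ⟪u', v y⟫} x (h * x * h⁻¹) := by
  obtain ⟨x, hx, hT⟩ := exists_connIn_commute_pos hv hx hT
  have hF : ∃ F : Set H, F.Finite ∧ x ∈ F ∧ (∀ y ∈ F, 0 < ⟪u, v y⟫) ∧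
      ∀ s ∈ T, ConnIn Commute F x (s * x * s⁻¹) := by
    choose! F hF hfin hc using fun s (hs : s ∈ T) => (hT s hs).exists_finite
    refine ⟨insert x (⋃ s ∈ T, F s), (hTfin.biUnion hfin).insert x, Set.mem_insert _ _, ?_, ?_⟩
    · rintro y (rfl | hy)
      · exact hx
      · obtain ⟨s, hs, hy⟩ := Set.mem_iUnion₂.1 hy
        exact hF s hs hy
    · exact fun s hs => (hc s hs).mono
        ((Set.subset_biUnion_of_mem hs).trans (Set.subset_insert _ _))
  obtain ⟨F, hFfin, hxF, hFpos, hFc⟩ := hF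
  obtain ⟨ε, hε, hε0⟩ : ∃ ε : ℝ, (∀ y ∈ F, ε < ⟪u, v y⟫) ∧ 0 < ε := by
    have h1 : ∀ᶠ ε : ℝ in 𝓝[>] 0, ∀ y ∈ F, ε < ⟪u, v y⟫ :=
      (eventually_all_finite hFfin).2 fun y hy =>
        eventually_nhdsWithin_of_eventually_nhds (eventually_lt_nhds (hFpos y hy))
    exact (h1.and self_mem_nhdsWithin).exists
  have hW : {u' | ∀ y ∈ F, ε < ⟪u', v y⟫} ∈ 𝓝 u :=
    (eventually_all_finite hFfin).2 fun y hy =>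
      ((continuous_id.inner continuous_const).tendsto u).eventually (lt_mem_nhds (hε y hy))
  refine ⟨x, ε, hε0, _, hW, fun u' hu' => hu' x hxF, connIn_commute_conj ?_ hgen fun s hs =>
    (hFc s hs).mono fun y hy u' hu' => hu' y hy⟩
  intro h y hy u' hu'
  rw [map_conj_of_map_mul hv]
  exact hy u' hu'

/-- **Commuting chains force finite generation.** Let `v : H → E` turn products into sums, with
integral squared norms, and let `π` be a homomorphism such that `v` is trivial on `ker π` and balls
contain finitely many classes of `π`. If every nonzero linear form `u` on `E` admits an
element of nonzero height that is linked to its conjugates by generators through chains of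
commuting elements of nonzero height, then `ker π` is finitely generated. -/
theorem MonoidHom.ker_fg_of_connIn_commute [FiniteDimensional ℝ E] {Q : Type*} [Group Q]
    (π : H →* Q) (hv : ∀ a b, v (a * b) = v a + v b) {N : H → ℕ} (hN : ∀ h, ‖v h‖ ^ 2 = N h)
    (hπ : ∀ k ∈ π.ker, v k = 0) (hfin : ∀ R : ℕ, (π '' {h | N h ≤ R}).Finite)
    (hFG : Group.FG H)
    (hchain : ∀ u : E, u ≠ 0 → ∃ T : Set H, T.Finite ∧ Subgroup.closure T = ⊤ ∧
      ∃ x, ⟪u, v x⟫ ≠ 0 ∧ ∀ s ∈ T, ConnIn Commute {y | ⟪u, v y⟫ ≠ 0} x (s * x * s⁻¹)) :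
    π.ker.FG := by
  have hloc : ∀ u : E, u ∈ Metric.sphere (0 : E) 1 → ∃ (x : H) (ε : ℝ), 0 < ε ∧ ∃ W ∈ 𝓝 u,
      (∀ u' ∈ W, ε < ⟪u', v x⟫) ∧
      ∀ h, ConnIn Commute {y | ∀ u' ∈ W, ε < ⟪u', v y⟫} x (h * x * h⁻¹) := by
    intro u hu
    have hu0 : u ≠ 0 := by
      rintro rfl
      simp at hu
    obtain ⟨T, hTfin, hgen, x, hx, hT⟩ := hchain u hu0
    exact exists_nhds_connIn_commute hv hTfin hgen hx hT
  choose! x ε hε W hW hx hc using hloc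
  obtain ⟨J, hJ, hcover⟩ := (isCompact_sphere (0 : E) 1).elim_nhds_subcover W hW
  obtain ⟨T, hT, hTfin⟩ := Group.fg_iff.1 hFG
  -- The elements `x j` found for the members of the finite cover are made generators.
  set X₀ : Set H := T ∪ x '' J with hX₀
  set X : Set H := X₀ ∪ X₀⁻¹ with hX
  have hX₀fin : X₀.Finite := hTfin.union (J.finite_toSet.image x)
  have hXfin : X.Finite := hX₀fin.union hX₀fin.inv
  have hXinv : ∀ y ∈ X, y⁻¹ ∈ X := by
    rintro y (hy | hy)
    · exact Or.inr (by simpa using hy)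
    · exact Or.inl hy
  have hXgen : Subgroup.closure X = ⊤ :=
    top_le_iff.1 (hT ▸ Subgroup.closure_mono
      (Set.subset_union_left.trans Set.subset_union_left))
  have hxX : ∀ j ∈ J, x j ∈ X := fun j hj => Or.inl (Or.inr ⟨j, hj, rfl⟩)
  obtain ⟨δ, hδ, hδ0⟩ : ∃ δ : ℝ, (∀ j ∈ J, δ < ε j) ∧ 0 < δ := by
    have h1 : ∀ᶠ δ : ℝ in 𝓝[>] 0, ∀ j ∈ J, δ < ε j :=
      (Finset.eventually_all J).2 fun j hj =>
        eventually_nhdsWithin_of_eventually_nhds (eventually_lt_nhds (hε j (hJ j hj)))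
    exact (h1.and self_mem_nhdsWithin).exists
  have hpush : ∀ j ∈ J, ∀ s ∈ X, ConnIn (CayleyAdj X)
      {p | ∀ u ∈ W j ∩ Metric.sphere 0 1, min 0 ⟪u, v s⟫ + ε j < ⟪u, v p⟫} (x j) (s * x j) := by
    intro j hj s hs
    have h := hc j (hJ j hj) s
    refine connIn_push hv hXinv hXgen (fun u hu => by simpa using hu.2)
      (hε j (hJ j hj)) (hxX j hj) hs (fun u hu => hx j (hJ j hj) u hu.1)
      (h.mono fun y hy u hu => ?_)
    exact hy u hu.1
  -- Finitely many paths are involved, so that they stay within bounded distance of `1`.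
  obtain ⟨D, hD, hxD⟩ : ∃ D : ℝ, (∀ j ∈ J, ∀ s ∈ X, ConnIn (CayleyAdj X)
      {p | (∀ u ∈ W j ∩ Metric.sphere 0 1, min 0 ⟪u, v s⟫ + ε j < ⟪u, v p⟫) ∧ ‖v p‖ ≤ D}
      (x j) (s * x j)) ∧ ∀ j ∈ J, ‖v (x j)‖ ≤ D := by
    refine (Eventually.and ((Finset.eventually_all J).2 fun j hj =>
      (eventually_all_finite hXfin).2 fun s hs => ?_)
      ((Finset.eventually_all J).2 fun j _ => eventually_ge_atTop _) :
        ∀ᶠ D : ℝ in atTop, _).exists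
    obtain ⟨F, hF, hFfin, hFc⟩ := (hpush j hj s hs).exists_finite
    filter_upwards [(eventually_all_finite hFfin).2 fun p _ => eventually_ge_atTop ‖v p‖] with D hD
    exact hFc.mono fun p hp => ⟨hF hp, hD p hp⟩
  have hpush' : ∀ u : E, ‖u‖ = 1 → ∃ t ∈ X, (δ < ⟪u, v t⟫ ∧ ‖v t‖ ≤ D) ∧
      ∀ s ∈ X, 0 ≤ ⟪u, v s⟫ →
        ConnIn (CayleyAdj X) {p | δ < ⟪u, v p⟫ ∧ ‖v p‖ ≤ D} t (s * t) := by
    intro u hu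
    have hu' : u ∈ Metric.sphere (0 : E) 1 := by simpa using hu
    obtain ⟨j, hj, huj⟩ := Set.mem_iUnion₂.1 (hcover hu')
    refine ⟨x j, hxX j hj, ⟨(hδ j hj).trans (hx j (hJ j hj) u huj), hxD j hj⟩, fun s hs hs0 => ?_⟩
    refine (hD j hj s hs).mono fun p hp => ⟨?_, hp.2⟩
    have h1 := hp.1 u ⟨huj, hu'⟩
    rw [min_eq_left hs0, zero_add] at h1
    exact (hδ j hj).trans h1
  obtain ⟨R, hR⟩ : ∃ R : ℕ, ∀ r : ℕ, R < r → D ^ 2 < 2 * δ * √r := by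
    obtain ⟨R, hR⟩ := exists_nat_gt ((D ^ 2 / (2 * δ)) ^ 2)
    refine ⟨R, fun r hr => ?_⟩
    have h1 : D ^ 2 / (2 * δ) < √r :=
      Real.lt_sqrt_of_sq_lt (hR.trans (by exact_mod_cast hr))
    rwa [div_lt_iff₀ (by positivity), mul_comm] at h1
  have hN0 : ∀ k ∈ π.ker, N k = 0 := by
    intro k hk
    have := hN k
    rw [hπ k hk] at this
    simpa using this.symm
  refine π.ker_fg_of_connIn hXfin (hfin R) fun k hk => ?_
  have hdesc : ∀ i : ℕ, ConnIn (CayleyAdj X) {h | N h ≤ R + i} 1 k →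
      ConnIn (CayleyAdj X) {h | N h ≤ R} 1 k := by
    intro i
    induction i with
    | zero => exact fun h => h
    | succ i ih =>
      intro h
      refine ih ((ConnIn.lt_of_le hv hN hXinv hpush' (hR _ (by omega)) ?_ ?_ h).mono
        fun p hp => Nat.lt_succ_iff.1 hp)
      · rw [hN0 1 π.ker.one_mem]; omega
      · rw [hN0 k hk]; omega
  obtain ⟨F, -, hFfin, hFc⟩ := (connIn_cayley_univ hXinv hXgen k).exists_finite
  obtain ⟨i, hi⟩ := (hFfin.image N).bddAbove
  exact hdesc i (hFc.mono fun p hp => (hi ⟨p, hp, rfl⟩).trans (Nat.le_add_left _ _))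

end Kernel

/-! ### Finitely generated abelian groups as lattices up to torsion -/

/-- A finitely generated abelian group maps onto a standard lattice `ℤᵈ` with finite kernel. The
integral squared norm is recorded by `N`, the finiteness of the kernel by that of the balls, and
all that is needed of surjectivity is that no nonzero linear form vanishes on the image. -/
theorem AddCommGroup.exists_lattice_map (A : Type*) [AddCommGroup A] [AddGroup.FG A] :
    ∃ (d : ℕ) (f : A →+ EuclideanSpace ℝ (Fin d)) (N : A → ℕ), (∀ a, ‖f a‖ ^ 2 = N a) ∧
      (∀ R : ℕ, {a | N a ≤ R}.Finite) ∧ ∀ u, u ≠ 0 → ∃ a, inner ℝ u (f a) ≠ (0 : ℝ) := by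
  classical
  obtain ⟨d, ι, _, p, hp, e, ⟨E⟩⟩ := AddCommGroup.equiv_free_prod_directSum_zmod A
  have : ∀ i, NeZero (p i ^ e i) := fun i => ⟨pow_ne_zero _ (hp i).ne_zero⟩
  have : Finite (DirectSum ι fun i => ZMod (p i ^ e i)) :=
    Finite.of_equiv _ (DirectSum.addEquivProd fun i => ZMod (p i ^ e i)).symm.toEquiv
  let f : A →+ EuclideanSpace ℝ (Fin d) :=
    { toFun := fun a => WithLp.toLp 2 fun i => (((E a).1 i : ℤ) : ℝ)
      map_zero' := by ext; simp
      map_add' := fun a b => by ext; simp }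
  refine ⟨d, f, fun a => ∑ i, ((E a).1 i).natAbs ^ 2, fun a => ?_, fun R => ?_, fun u hu => ?_⟩
  · rw [EuclideanSpace.norm_sq_eq]
    push_cast
    refine Finset.sum_congr rfl fun i _ => ?_
    simp [f, Nat.cast_natAbs]
  · have hbox : (Set.univ.pi fun _ : Fin d => Set.Icc (-(R : ℤ)) R).Finite :=
      Set.Finite.pi fun _ => Set.finite_Icc _ _
    have hfin := (hbox.prod (Set.finite_univ (α := DirectSum ι fun i => ZMod (p i ^ e i)))).preimage
      (f := fun a => (⇑(E a).1, (E a).2)) (fun a _ b _ hab => by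
        have := Prod.ext_iff.1 hab
        exact E.injective (Prod.ext (DFunLike.coe_injective this.1) this.2))
    refine hfin.subset fun a ha => ⟨fun i _ => ?_, trivial⟩
    have h1 : ((E a).1 i).natAbs ^ 2 ≤ R :=
      (Finset.single_le_sum (f := fun i => ((E a).1 i).natAbs ^ 2)
        (fun _ _ => Nat.zero_le _) (Finset.mem_univ i)).trans ha
    have h2 : ((E a).1 i).natAbs ≤ R := (Nat.le_self_pow two_ne_zero _).trans h1
    simp only [Set.mem_Icc]
    omega
  · obtain ⟨i, hi⟩ : ∃ i, u i ≠ 0 := by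
      by_contra! h
      exact hu (by ext i; simpa using h i)
    refine ⟨E.symm (Finsupp.single i 1, 0), ?_⟩
    have : f (E.symm (Finsupp.single i 1, 0)) = EuclideanSpace.single i (1 : ℝ) := by
      ext j
      by_cases h : j = i
      · subst h; simp [f]
      · simp [f, h]
    rw [this, EuclideanSpace.inner_single_right]
    simpa using hi

/-! ### Nonvanishing loci on the graded pieces -/

section Nonvanishing

open Topology

variable {n : ℕ} {Γ : Type*} [Group Γ] {G : Subgroup Γ}

theorem NGroup.mem_conjSubgroup {g x : Γ} {H : Subgroup Γ} :
    x ∈ NGroup.conjSubgroup g H ↔ g⁻¹ * x * g ∈ H := by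
  constructor
  · rintro ⟨y, hy, rfl⟩
    simpa [mul_assoc] using hy
  · intro h
    exact ⟨_, h, by simp [mul_assoc]⟩

theorem NGroup.conjSubgroup_conjSubgroup (g h : Γ) (H : Subgroup Γ) :
    NGroup.conjSubgroup g (NGroup.conjSubgroup h H) = NGroup.conjSubgroup (g * h) H := by
  ext x
  simp [NGroup.mem_conjSubgroup, mul_assoc]

namespace NormalCentralSeries

variable (s : NormalCentralSeries G) (k : ℕ+)

theorem conjRep_toGraded_mk (γ : Γ) (x : s.term k) :
    s.conjRep k γ (s.toGraded k (QuotientGroup.mk x)) =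
      s.toGraded k (QuotientGroup.mk (MulAut.conjNormal γ x)) := rfl

/-- The set of `γ` such that a given linear form on `ℒ(k)` does not vanish on the image of
`γ H γ⁻¹ ∩ G(k)`. -/
def nonvanishingLocus (φ : Module.Dual ℝ (s.Graded k)) (H : Subgroup Γ) : Set Γ :=
  {γ | ∃ x : s.term k, (x : Γ) ∈ H ∧ φ (s.conjRep k γ (s.toGraded k (QuotientGroup.mk x))) ≠ 0}

theorem isOpen_nonvanishingLocus (φ : Module.Dual ℝ (s.Graded k)) (H : Subgroup Γ) :
    IsOpen[pullbackZariskiTopology (s.conjRep k)] (s.nonvanishingLocus k φ H) := by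
  let _ := pullbackZariskiTopology (s.conjRep k)
  have : s.nonvanishingLocus k φ H = ⋃ x : {x : s.term k // (x : Γ) ∈ H},
      {γ | φ (s.conjRep k γ (s.toGraded k (QuotientGroup.mk x.1))) ≠ 0} := by
    ext γ
    simp [nonvanishingLocus]
  rw [this]
  refine isOpen_iUnion fun x => ?_
  exact @isOpen_induced _ _ (zariskiTopology (s.Graded k)) (s.conjRep k).toHomUnits
    {g | φ ((g : s.Graded k →ₗ[ℝ] s.Graded k) (s.toGraded k (QuotientGroup.mk x.1))) ≠ 0}
    (TopologicalSpace.isOpen_generateFrom_of_mem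
      ⟨_, Algebra.subset_adjoin ⟨φ, _, fun _ => rfl⟩, rfl⟩)

/-- If `ℒ(k)` is generated in degree at most `m`, then a nonzero linear form has nonempty
nonvanishing locus for each vertex of the `m`-commuting graph. -/
theorem nonvanishingLocus_nonempty (S : NGroup n Γ) (htrans : S.IsTransitive) {m : ℕ}
    (hmn : m ≤ n) (hm : generationDegree (s.gradedNVectorSpace S k) (s.conjRep k) ≤ m)
    {φ : Module.Dual ℝ (s.Graded k)} (hφ : φ ≠ 0) (H : S.CommutingGraphVertex m) :
    (s.nonvanishingLocus k φ H.1).Nonempty := by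
  set W := s.gradedNVectorSpace S k with hW
  have hspan := Nat.sInf_mem (s := {d : ℕ | Submodule.span ℝ {x : s.Graded k |
      ∃ I : Finset (Fin n), I.card = d ∧ ∃ γ : Γ, ∃ v ∈ W.sub I, x = s.conjRep k γ v} = ⊤}) (by
    refine ⟨n, top_le_iff.1 fun x _ => Submodule.subset_span ⟨Finset.univ, by simp, 1, x, ?_, ?_⟩⟩
    · rw [W.sub_univ]; trivial
    · simp)
  obtain ⟨I, hI, γ, v, hv, hne⟩ : ∃ I : Finset (Fin n),
      I.card = generationDegree W (s.conjRep k) ∧ ∃ γ : Γ, ∃ v ∈ W.sub I,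
        φ (s.conjRep k γ v) ≠ 0 := by
    by_contra! h
    refine hφ (LinearMap.ext_on hspan ?_)
    rintro _ ⟨I, hI, γ, v, hv, rfl⟩
    exact h I hI γ v hv
  obtain ⟨x, hxI, hx⟩ : ∃ x : s.term k, (x : Γ) ∈ S.sub I ∧
      φ (s.conjRep k γ (s.toGraded k (QuotientGroup.mk x))) ≠ 0 := by
    by_contra! h
    refine hne ?_
    have : W.sub I ≤ LinearMap.ker (φ ∘ₗ s.conjRep k γ) := by
      refine Submodule.span_le.2 ?_
      rintro _ ⟨_, ⟨x, hx, rfl⟩, rfl⟩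
      exact h x hx
    exact this hv
  obtain ⟨J, hIJ, -, hJ⟩ := Finset.exists_subsuperset_card_eq (Finset.subset_univ I)
    (hI.trans_le hm) (by simpa using hmn)
  obtain ⟨K, hK, g, hg⟩ := H.2
  obtain ⟨c, hc⟩ := htrans K J (hK.trans hJ.symm)
  have hxJ : (x : Γ) ∈ NGroup.conjSubgroup (c * g⁻¹) H.1 := by
    rw [hg, NGroup.conjSubgroup_conjSubgroup, inv_mul_cancel_right, hc]
    exact S.mono hIJ hxI
  refine ⟨γ * (c * g⁻¹), MulAut.conjNormal (c * g⁻¹)⁻¹ x, ?_, ?_⟩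
  · simpa [NGroup.mem_conjSubgroup, mul_assoc] using hxJ
  · rw [← conjRep_toGraded_mk, ← Module.End.mul_apply, ← map_mul, mul_inv_cancel_right]
    exact hx

/-- By irreducibility, finitely many nonvanishing loci have a common point. -/
theorem exists_forall_mem_nonvanishingLocus (hirr : IsZariskiIrreducible (s.conjRep k))
    (φ : Module.Dual ℝ (s.Graded k)) {V : Set (Subgroup Γ)} (hV : V.Finite)
    (hne : ∀ H ∈ V, (s.nonvanishingLocus k φ H).Nonempty) :
    ∃ γ, ∀ H ∈ V, γ ∈ s.nonvanishingLocus k φ H := by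
  classical
  let _ := pullbackZariskiTopology (s.conjRep k)
  have : IrreducibleSpace Γ := hirr
  obtain ⟨γ, -, hγ⟩ := isIrreducible_iff_sInter.1 (IrreducibleSpace.isIrreducible_univ Γ)
    (hV.toFinset.image (s.nonvanishingLocus k φ))
    (by
      intro U hU
      obtain ⟨H, -, rfl⟩ := Finset.mem_image.1 hU
      exact s.isOpen_nonvanishingLocus k φ H)
    (by
      intro U hU
      obtain ⟨H, hH, rfl⟩ := Finset.mem_image.1 hU
      simpa using hne H (by simpa using hH))
  exact ⟨γ, fun H hH => hγ _ (by simpa using ⟨H, hH, rfl⟩)⟩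

end NormalCentralSeries

end Nonvanishing

/-! ### From the commuting graph to chains of commuting elements -/

section CommutingGraph

variable {n : ℕ} {Γ : Type*} [Group Γ] {G : Subgroup Γ}

namespace NGroup

variable (S : NGroup n Γ) {m : ℕ}

/-- The action of `Γ` on the vertices of the `m`-commuting graph by conjugation. -/
def conjVertex (g : Γ) (H : S.CommutingGraphVertex m) : S.CommutingGraphVertex m :=
  ⟨conjSubgroup g H.1, by
    obtain ⟨I, hI, h, hh⟩ := H.2
    exact ⟨I, hI, g * h, by rw [hh, conjSubgroup_conjSubgroup]⟩⟩

/-- Some pair of vertices, equal only if there is a single vertex, commutes elementwise. -/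
theorem exists_commuteElementwise (hconn : (S.commutingGraph m).Connected)
    (hdeg : Subsingleton (S.CommutingGraphVertex m) →
      ∀ H : S.CommutingGraphVertex m, CommuteElementwise H.1 H.1) :
    ∃ b c : S.CommutingGraphVertex m, CommuteElementwise b.1 c.1 := by
  obtain ⟨b⟩ := hconn.nonempty
  rcases subsingleton_or_nontrivial (S.CommutingGraphVertex m) with h | h
  · exact ⟨b, b, hdeg h b⟩
  · obtain ⟨c, hc⟩ := hconn.preconnected.exists_adj_of_nontrivial b
    exact ⟨b, c, hc.2⟩

end NGroup

/-- After conjugation by a suitable `γ`, all the vertices on paths of the commuting graph from `c`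
to its conjugates by a finite set of generators meet `G(k)` in elements on which `φ` does not
vanish. If `b` and `c` commute elementwise, such an element of `γ b γ⁻¹` is thereby linked to its
conjugates by generators; the detour through `c` ensures that consecutive elements commute. -/
theorem NormalCentralSeries.exists_connIn_commute (s : NormalCentralSeries G) (k : ℕ+)
    (S : NGroup n Γ) (htrans : S.IsTransitive) {m : ℕ} (hmn : m ≤ n)
    (hm : generationDegree (s.gradedNVectorSpace S k) (s.conjRep k) ≤ m)
    (hirr : IsZariskiIrreducible (s.conjRep k))
    (hconn : (S.commutingGraph m).Connected)
    (hdeg : Subsingleton (S.CommutingGraphVertex m) →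
      ∀ H : S.CommutingGraphVertex m, NGroup.CommuteElementwise H.1 H.1)
    (hFG : Group.FG (s.term k)) {φ : Module.Dual ℝ (s.Graded k)} (hφ : φ ≠ 0) :
    ∃ T : Set (s.term k), T.Finite ∧ Subgroup.closure T = ⊤ ∧
      ∃ x, φ (s.toGraded k (QuotientGroup.mk x)) ≠ 0 ∧ ∀ t ∈ T,
        ConnIn Commute {y | φ (s.toGraded k (QuotientGroup.mk y)) ≠ 0} x (t * x * t⁻¹) := by
  obtain ⟨T₀, hT₀, hT₀fin⟩ := Group.fg_iff.1 hFG
  obtain ⟨b, c, hbc⟩ := S.exists_commuteElementwise hconn hdeg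
  have hpath : ∀ t : s.term k, ∃ F : Set (S.CommutingGraphVertex m), F.Finite ∧
      ConnIn (S.commutingGraph m).Adj F c (S.conjVertex (t : Γ) c) := by
    intro t
    have h := (SimpleGraph.reachable_iff_reflTransGen _ _).1
      (hconn.preconnected c (S.conjVertex (t : Γ) c))
    have h' : ConnIn (S.commutingGraph m).Adj Set.univ c (S.conjVertex (t : Γ) c) :=
      Relation.ReflTransGen.mono (fun _ _ hab => ⟨trivial, trivial, hab⟩) _ _ h
    obtain ⟨F, -, hF, hFc⟩ := h'.exists_finite
    exact ⟨F, hF, hFc⟩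
  choose F hF hFc using hpath
  obtain ⟨γ, hγ⟩ : ∃ γ, ∀ H ∈ ({b, c} ∪ ⋃ t ∈ T₀, (F t ∪ {S.conjVertex (t : Γ) c})),
      γ ∈ s.nonvanishingLocus k φ H.1 := by
    have hV : (({b, c} : Set (S.CommutingGraphVertex m)) ∪
        ⋃ t ∈ T₀, (F t ∪ {S.conjVertex (t : Γ) c})).Finite :=
      (Set.toFinite _).union (hT₀fin.biUnion fun t _ => (hF t).union (Set.finite_singleton _))
    obtain ⟨γ, hγ⟩ := s.exists_forall_mem_nonvanishingLocus k hirr φ (hV.image Subtype.val) (by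
      rintro _ ⟨H, -, rfl⟩
      exact s.nonvanishingLocus_nonempty k S htrans hmn hm hφ H)
    exact ⟨γ, fun H hH => hγ _ ⟨H, hH, rfl⟩⟩
  choose! y hyH hy using hγ
  have hb : b ∈ ({b, c} ∪ ⋃ t ∈ T₀, (F t ∪ {S.conjVertex (t : Γ) c}) :
      Set (S.CommutingGraphVertex m)) := Or.inl (Or.inl rfl)
  have hc : c ∈ ({b, c} ∪ ⋃ t ∈ T₀, (F t ∪ {S.conjVertex (t : Γ) c}) :
      Set (S.CommutingGraphVertex m)) := Or.inl (Or.inr rfl)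
  have hFV : ∀ t ∈ T₀, F t ⊆ ({b, c} ∪ ⋃ t ∈ T₀, (F t ∪ {S.conjVertex (t : Γ) c})) :=
    fun t ht H hH => Or.inr (Set.mem_iUnion₂.2 ⟨t, ht, Or.inl hH⟩)
  have htV : ∀ t ∈ T₀, S.conjVertex (t : Γ) c ∈
      ({b, c} ∪ ⋃ t ∈ T₀, (F t ∪ {S.conjVertex (t : Γ) c})) :=
    fun t ht => Or.inr (Set.mem_iUnion₂.2 ⟨t, ht, Or.inr rfl⟩)
  generalize ({b, c} ∪ ⋃ t ∈ T₀, (F t ∪ {S.conjVertex (t : Γ) c})) = V at *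
  let σ : MulAut (s.term k) := MulAut.conjNormal γ
  have hcomm : ∀ x z : s.term k, (x : Γ) * z = z * x → Commute (σ x) (σ z) := by
    intro x z h
    have : Commute x z := Subtype.ext h
    exact this.map σ
  refine ⟨σ '' T₀, hT₀fin.image _, ?_, σ (y b), hy b hb, ?_⟩
  · have := MonoidHom.map_closure σ.toMonoidHom T₀
    rw [hT₀, Subgroup.map_top_of_surjective σ.toMonoidHom σ.surjective] at this
    exact this.symm
  rintro _ ⟨t, ht, rfl⟩
  have hconj : φ (s.toGraded k (QuotientGroup.mk (σ t * σ (y b) * (σ t)⁻¹))) ≠ 0 := by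
    have : (QuotientGroup.mk (σ t * σ (y b) * (σ t)⁻¹) : s.Subquotient k) =
        QuotientGroup.mk (σ (y b)) := by
      rw [QuotientGroup.mk_mul, QuotientGroup.mk_mul, QuotientGroup.mk_inv]
      exact mul_inv_cancel_comm _ _
    rw [this]
    exact hy b hb
  have hlast : (y (S.conjVertex (t : Γ) c) : Γ) * (t * y b * t⁻¹ : s.term k) =
      (t * y b * t⁻¹ : s.term k) * (y (S.conjVertex (t : Γ) c) : Γ) := by
    have h1 := NGroup.mem_conjSubgroup.1 (hyH _ (htV t ht))
    have h2 := hbc _ (hyH b hb) _ h1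
    have h3 := congrArg (fun g => (t : Γ) * g * (t : Γ)⁻¹) h2
    simpa [mul_assoc] using h3.symm
  refine .trans (.single (hy b hb) (hy c hc) (hcomm _ _ (hbc _ (hyH b hb) _ (hyH c hc)))) ?_
  refine .trans ((hFc t).map (fun H => σ (y H)) (fun H hH => hy H (hFV t ht hH))
    fun H hH K hK h => hcomm _ _ (h.2 _ (hyH H (hFV t ht hH)) _ (hyH K (hFV t ht hK)))) ?_
  have := hcomm _ _ hlast
  rw [map_mul, map_mul, map_inv] at this
  exact .single (hy _ (htV t ht)) hconj this

end CommutingGraph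

/-! ### Descending along the central series -/

/-- The step from `G(k)` to `G(k + 1)`. -/
theorem NormalCentralSeries.fg_succ {n : ℕ} {Γ : Type*} [Group Γ] {G : Subgroup Γ}
    (s : NormalCentralSeries G) (k : ℕ+)
    (S : NGroup n Γ) (htrans : S.IsTransitive) {m : ℕ} (hmn : m ≤ n)
    (hm : generationDegree (s.gradedNVectorSpace S k) (s.conjRep k) ≤ m)
    (hirr : IsZariskiIrreducible (s.conjRep k))
    (hconn : (S.commutingGraph m).Connected)
    (hdeg : Subsingleton (S.CommutingGraphVertex m) →
      ∀ H : S.CommutingGraphVertex m, NGroup.CommuteElementwise H.1 H.1)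
    (hFG : (s.term k).FG) : (s.term (k + 1)).FG := by
  have : Group.FG (s.term k) := (Group.fg_iff_subgroup_fg _).2 hFG
  have : Group.FG (s.Subquotient k) :=
    Group.fg_of_surjective (QuotientGroup.mk'_surjective ((s.term (k + 1)).subgroupOf (s.term k)))
  obtain ⟨d, f, N, hN, hfin, hf⟩ := AddCommGroup.exists_lattice_map (Additive (s.Subquotient k))
  have hker : (QuotientGroup.mk' ((s.term (k + 1)).subgroupOf (s.term k))).ker.FG := by
    refine MonoidHom.ker_fg_of_connIn_commute _
      (v := fun x => f (Additive.ofMul (QuotientGroup.mk x : s.Subquotient k)))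
      (fun a b => f.map_add (Additive.ofMul (QuotientGroup.mk a : s.Subquotient k))
        (Additive.ofMul (QuotientGroup.mk b : s.Subquotient k)))
      (N := fun x => N (Additive.ofMul (QuotientGroup.mk x : s.Subquotient k)))
      (fun x => hN _) ?_ ?_ inferInstance ?_
    · intro x hx
      have : (QuotientGroup.mk x : s.Subquotient k) = 1 := hx
      rw [this]
      exact f.map_zero
    · intro R
      refine ((hfin R).image Additive.toMul).subset ?_
      rintro _ ⟨x, hx, rfl⟩
      exact ⟨_, hx, rfl⟩
    · intro u hu
      let l : Additive (s.Subquotient k) →ₗ[ℤ] ℝ :=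
        ((innerₛₗ ℝ u).toAddMonoidHom.comp f).toIntLinearMap
      let φ : Module.Dual ℝ (s.Graded k) := l.liftBaseChange ℝ
      have hφ : ∀ q, φ (s.toGraded k q) = inner ℝ u (f (Additive.ofMul q)) := by
        intro q
        simp [φ, l, toGraded]
      have hφ0 : φ ≠ 0 := by
        intro h
        obtain ⟨a, ha⟩ := hf u hu
        refine ha ?_
        have := hφ a.toMul
        rw [h] at this
        exact this.symm
      have := s.exists_connIn_commute k S htrans hmn hm hirr hconn hdeg inferInstance hφ0
      simpa only [hφ] using this
  rw [QuotientGroup.ker_mk'] at hker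
  have := (Group.fg_iff_subgroup_fg _).2 hker
  exact (Group.fg_iff_subgroup_fg _).1
    (Group.fg_of_surjective (f := (Subgroup.subgroupOfEquivOfLe (s.succ_le k)).toMonoidHom)
      (Subgroup.subgroupOfEquivOfLe (s.succ_le k)).surjective)

theorem mainTheorem6 {n : ℕ} (hn : 1 ≤ n) {Γ : Type*} [Group Γ] (S : NGroup n Γ)
    (G : Subgroup Γ) [G.Normal] (s : NormalCentralSeries G) (N : ℕ+)
    (htrans : S.IsTransitive)
    (hfg : G.FG)
    (hirr : ∀ k : ℕ+, IsZariskiIrreducible (s.conjRep k))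
    (m : ℕ) (hmn : m ≤ n)
    (hm : ∀ k : ℕ+, k < N → generationDegree (s.gradedNVectorSpace S k) (s.conjRep k) ≤ m)
    (hconn : (S.commutingGraph m).Connected)
    (hdeg : Subsingleton (S.CommutingGraphVertex m) →
      ∀ H : S.CommutingGraphVertex m, NGroup.CommuteElementwise H.1 H.1) :
    ∀ k : ℕ+, k ≤ N → (s.term k).FG := by
  intro k
  induction k using PNat.recOn with
  | one => exact fun _ => by rwa [s.term_one]
  | succ k ih =>
    intro hk
    have hkN : k < N := (PNat.lt_add_right k 1).trans_le hk
    exact s.fg_succ k S htrans hmn (hm k hkN) (hirr k) hconn hdeg (ih hkN.le)
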